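/- Say that two units $u,v$ of a ring form a *free pair* if they freely generate a (non-abelian) free group of rank $2$, and that $z\in\mathbb C$ is *free* if $\begin{pmatrix}1&1\\0&1\end{pmatrix}$ and $\begin{pmatrix}1&0\\z&1\end{pmatrix}$ form a free pair. The *eigenvalues* of an element $x$ of a complex algebra $A$ are the eigenvalues of the $\mathbb C$-linear map $A\to A$, $y\mapsto xy$. Let $R$ be an associative ring with identity, not necessarily commutative, of characteristic $0$, and let $a,b\in R$ satisfy $a^2=b^2=0$. Regard $ab$ as an element of a complex algebra $A$, where either $A=\mathbb C\otimes_{\mathbb Z}R$ and $ab$ stands for $1\otimes ab$, or $A$ is any complex algebra into which $R$ embeds by a unital ring homomorphism and $ab$ stands for its image. Then, for each such $A$, $(1+a,1+b)$ is a free pair if and only if one of the following conditions holds: 1. $ab$ is transcendental over $\mathbb Q$; 2. $ab$ is algebraic over $\mathbb Q$ and at least one of the eigenvalues of $ab$ in $A$ is free. -/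

import Mathlib

open scoped TensorProduct

/-- Two elements `u`, `v` of a monoid (for instance of a ring) form a free pair if they are units
and freely generate a (non-abelian) free group of rank two, that is, the canonical homomorphism
from the free group on two letters to the group of units that sends the letters to `u` and `v` is
injective. -/
def IsFreePair {M : Type*} [Monoid M] (u v : M) : Prop :=
  ∃ U V : Mˣ, (U : M) = u ∧ (V : M) = v ∧
    Function.Injective (FreeGroup.lift ![U, V] : FreeGroup (Fin 2) →* Mˣ)

/-- A complex number `z` is a free point if the two elementary matrices
`[1, 1; 0, 1]` and `[1, 0; z, 1]` form a free pair. -/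
def IsFreePoint (z : ℂ) : Prop :=
  IsFreePair (!![1, 1; 0, 1] : Matrix (Fin 2) (Fin 2) ℂ) !![1, 0; z, 1]

/-- The complex number `z` is an eigenvalue of the element `x` of a complex algebra `A`: it is an
eigenvalue of the `ℂ`-linear endomorphism of `A` given by left multiplication by `x`. -/
def IsEigenvalueOf {A : Type*} [Ring A] [Algebra ℂ A] (x : A) (z : ℂ) : Prop :=
  Module.End.HasEigenvalue (LinearMap.mulLeft ℂ x) z

/-! Put `c = ab`. Since `a² = b² = 0`, a word `w` in `1 + a`, `1 + b` expands as `1 + c p(c) + q(c)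
a + b r(c) + b s(c) a`, with the same polynomials as the matrix `M_w = [1 + Xp, q; Xr, 1 + Xs]` that
`w` gives in the transvections `[1, 1; 0, 1]`, `[1, 0; X, 1]` (`exists_expansion`). If `w` is
trivial in `A`, then `c` is a root of the entries of `X² (M_w - 1)`; if `m(c) = 0` and `X m` divides
`M_w - 1`, then `w` is trivial in `A`.

For transcendental `c` this forces `M_w = 1`, and `w ↦ M_w` is faithful by ping-pong at `X = 4`. A
free eigenvalue `z` is nonzero, so the relation becomes `M_w(z) = 1`, whence `w = 1`. If `c` is
algebraic without free eigenvalues, each root of its minimal polynomial, and also `0`, has a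
nontrivial word killed there; iterated commutators of conjugates of these give a nontrivial `w` with
`X m ∣ M_w - 1` (`exists_word_congr`).

Tensoring with `ℂ` kills only additive torsion, which cannot contain `w - 1` for `w ≠ 1` when the
pair is free (`eq_one_of_zsmul_eq_zero`). -/

namespace FreePair

open Polynomial

/-! ### Words in two unipotent units -/

/-- The unit `1 + a` attached to an element `a` of square zero. -/
def oneAddUnit {S : Type*} [Ring S] (a : S) (ha : a ^ 2 = 0) : Sˣ where
  val := 1 + a
  inv := 1 - a
  val_inv := by
    have : (1 + a) * (1 - a) = 1 - a ^ 2 := by noncomm_ring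
    rw [this, ha, sub_zero]
  inv_val := by
    have : (1 - a) * (1 + a) = 1 - a ^ 2 := by noncomm_ring
    rw [this, ha, sub_zero]

theorem coe_oneAddUnit {S : Type*} [Ring S] (a : S) (ha : a ^ 2 = 0) :
    (oneAddUnit a ha : S) = 1 + a := rfl

theorem coe_inv_oneAddUnit {S : Type*} [Ring S] (a : S) (ha : a ^ 2 = 0) :
    ((oneAddUnit a ha)⁻¹ : Sˣ) = 1 - a := rfl

theorem coe_oneAddUnit_zpow {S : Type*} [Ring S] (a : S) (ha : a ^ 2 = 0) (n : ℤ) :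
    ((oneAddUnit a ha ^ n : Sˣ) : S) = 1 + n * a := by
  induction n using Int.induction_on with
  | zero => simp
  | succ n ih =>
    rw [zpow_add_one, Units.val_mul, ih, coe_oneAddUnit, mul_add, mul_one, add_mul, mul_assoc,
      ← sq, ha]
    push_cast
    noncomm_ring
  | pred n ih =>
    rw [zpow_sub_one, Units.val_mul, ih, coe_inv_oneAddUnit, mul_sub, mul_one, add_mul, mul_assoc,
      ← sq, ha]
    push_cast
    noncomm_ring

/-- The homomorphism from the free group on two letters to the units of a ring that sends the
letters to `1 + a` and `1 + b`. -/
def wordHom {S : Type*} [Ring S] (a b : S) (ha : a ^ 2 = 0) (hb : b ^ 2 = 0) :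
    FreeGroup (Fin 2) →* Sˣ :=
  FreeGroup.lift ![oneAddUnit a ha, oneAddUnit b hb]

theorem isFreePair_iff {S : Type*} [Ring S] {a b : S} (ha : a ^ 2 = 0) (hb : b ^ 2 = 0) :
    IsFreePair (1 + a) (1 + b) ↔ Function.Injective (wordHom a b ha hb) := by
  constructor
  · rintro ⟨U, V, hU, hV, h⟩
    obtain rfl : U = oneAddUnit a ha := Units.ext hU
    obtain rfl : V = oneAddUnit b hb := Units.ext hV
    exact h
  · exact fun h => ⟨oneAddUnit a ha, oneAddUnit b hb, rfl, rfl, h⟩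

theorem sq_map_eq_zero {S T : Type*} [Ring S] [Ring T] (f : S →+* T) {a : S} (ha : a ^ 2 = 0) :
    f a ^ 2 = 0 := by
  rw [← map_pow, ha, map_zero]

theorem map_wordHom {S T : Type*} [Ring S] [Ring T] (f : S →+* T) {a b : S} (ha : a ^ 2 = 0)
    (hb : b ^ 2 = 0) {a' b' : T} (ha' : a' ^ 2 = 0) (hb' : b' ^ 2 = 0) (hfa : f a = a')
    (hfb : f b = b') (w : FreeGroup (Fin 2)) :
    f (wordHom a b ha hb w) = wordHom a' b' ha' hb' w := by
  subst hfa hfb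
  have h : (Units.map (f : S →* T)).comp (wordHom a b ha hb) = wordHom (f a) (f b) ha' hb' := by
    ext i
    fin_cases i <;> simp [wordHom, coe_oneAddUnit]
  rw [← h]
  rfl

theorem wordHom_eq_one_of_map {S T : Type*} [Ring S] [Ring T] (f : S →+* T) {a b : S}
    (ha : a ^ 2 = 0) (hb : b ^ 2 = 0) {a' b' : T} (ha' : a' ^ 2 = 0) (hb' : b' ^ 2 = 0)
    (hfa : f a = a') (hfb : f b = b') {w : FreeGroup (Fin 2)} (hw : wordHom a b ha hb w = 1) :
    wordHom a' b' ha' hb' w = 1 := by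
  apply Units.ext
  rw [← map_wordHom f ha hb ha' hb' hfa hfb, hw]
  simp

theorem injective_wordHom_of_map {S T : Type*} [Ring S] [Ring T] (f : S →+* T) {a b : S}
    (ha : a ^ 2 = 0) (hb : b ^ 2 = 0) {a' b' : T} (ha' : a' ^ 2 = 0) (hb' : b' ^ 2 = 0)
    (hfa : f a = a') (hfb : f b = b') (h : Function.Injective (wordHom a' b' ha' hb')) :
    Function.Injective (wordHom a b ha hb) := by
  rw [injective_iff_map_eq_one] at h ⊢
  exact fun w hw => h w (wordHom_eq_one_of_map f ha hb ha' hb' hfa hfb hw)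

theorem wordHom_injective_iff_of_injective {S T : Type*} [Ring S] [Ring T] (f : S →+* T)
    (hf : Function.Injective f) {a b : S}
    (ha : a ^ 2 = 0) (hb : b ^ 2 = 0) {a' b' : T} (ha' : a' ^ 2 = 0) (hb' : b' ^ 2 = 0)
    (hfa : f a = a') (hfb : f b = b') :
    Function.Injective (wordHom a b ha hb) ↔ Function.Injective (wordHom a' b' ha' hb') := by
  refine ⟨fun h => ?_, injective_wordHom_of_map f ha hb ha' hb' hfa hfb⟩
  rw [injective_iff_map_eq_one] at h ⊢
  refine fun w hw => h w (Units.ext (hf ?_))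
  rw [map_wordHom f ha hb ha' hb' hfa hfb, hw]
  simp

/-! ### Ping-pong -/

/-- The endomorphism `(u, v) ↦ (v, 0)` of `ℤ²`. -/
def upperEnd : Module.End ℤ (ℤ × ℤ) := LinearMap.inl ℤ ℤ ℤ ∘ₗ LinearMap.snd ℤ ℤ ℤ

/-- The endomorphism `(u, v) ↦ (0, 4u)` of `ℤ²`. -/
def lowerEnd : Module.End ℤ (ℤ × ℤ) := (4 : ℤ) • (LinearMap.inr ℤ ℤ ℤ ∘ₗ LinearMap.fst ℤ ℤ ℤ)

theorem upperEnd_sq : upperEnd ^ 2 = 0 := by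
  ext <;> simp [upperEnd, sq]

theorem lowerEnd_sq : lowerEnd ^ 2 = 0 := by
  ext <;> simp [lowerEnd, sq]

-- Ping-pong on the cones `|v| < 2|u|` and `2|u| < |v|`: every nonzero power of a generator maps one
-- cone into the other.
open scoped Pointwise in
theorem injective_wordHom_end :
    Function.Injective (wordHom upperEnd lowerEnd upperEnd_sq lowerEnd_sq) := by
  set g : Fin 2 → (Module.End ℤ (ℤ × ℤ))ˣ :=
    ![oneAddUnit upperEnd upperEnd_sq, oneAddUnit lowerEnd lowerEnd_sq] with hg
  have hlift : wordHom upperEnd lowerEnd upperEnd_sq lowerEnd_sq =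
      (Monoid.CoprodI.lift fun i => FreeGroup.lift fun _ => g i).comp
        (@freeGroupEquivCoprodI (Fin 2)).toMonoidHom := by
    refine FreeGroup.ext_hom _ _ fun i => ?_
    simp [wordHom, hg]
  rw [hlift, MonoidHom.coe_comp]
  refine Function.Injective.comp ?_ (MulEquiv.injective freeGroupEquivCoprodI)
  refine Monoid.CoprodI.lift_injective_of_ping_pong
    -- With only two factors, ping-pong needs one of them to have at least three elements; here it
    -- is infinite cyclic.
    (fun i : Fin 2 => (FreeGroup.lift fun _ => g i : FreeGroup Unit →* _)) (Or.inr ⟨0, ?_⟩)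
    (![{p : ℤ × ℤ | |p.2| < 2 * |p.1|}, {p : ℤ × ℤ | 2 * |p.1| < |p.2|}]) ?_ ?_ ?_
  · rw [FreeGroup.freeGroupUnitEquivInt.cardinal_eq, Cardinal.mk_denumerable]
    exact (Cardinal.natCast_lt_aleph0 (n := 3)).le
  · intro i
    fin_cases i
    · exact ⟨(1, 0), by simp⟩
    · exact ⟨(0, 1), by simp⟩
  · have hd : Disjoint {p : ℤ × ℤ | |p.2| < 2 * |p.1|} {p : ℤ × ℤ | 2 * |p.1| < |p.2|} :=
      Set.disjoint_left.2 fun p (hp : |p.2| < 2 * |p.1|) (hq : 2 * |p.1| < |p.2|) =>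
        lt_asymm hp hq
    intro i j hij
    fin_cases i <;> fin_cases j
    · exact absurd rfl hij
    · exact hd
    · exact hd.symm
    · exact absurd rfl hij
  · intro i j hij
    refine FreeGroup.freeGroupUnitEquivInt.forall_congr_left.mpr ?_
    intro n hne
    have hn : n ≠ 0 := by
      rintro rfl
      exact hne (by simp [FreeGroup.freeGroupUnitEquivInt])
    have hn1 : 1 ≤ |n| := Int.one_le_abs hn
    have hsymm : FreeGroup.freeGroupUnitEquivInt.symm n = FreeGroup.of () ^ n := rfl
    simp only [hsymm, map_zpow, FreeGroup.lift_apply_of]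
    rintro _ ⟨⟨u, v⟩, hp, rfl⟩
    fin_cases i <;> fin_cases j
    · exact absurd rfl hij
    · have hp' : 2 * |u| < |v| := hp
      have he : (g 0 ^ n) • ((u, v) : ℤ × ℤ) = (u + n * v, v) := by
        change ((oneAddUnit upperEnd upperEnd_sq ^ n : (Module.End ℤ (ℤ × ℤ))ˣ) :
          Module.End ℤ (ℤ × ℤ)) (u, v) = _
        rw [coe_oneAddUnit_zpow]
        ext <;> simp [upperEnd]
      change (g 0 ^ n) • ((u, v) : ℤ × ℤ) ∈ {p : ℤ × ℤ | |p.2| < 2 * |p.1|}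
      rw [he]
      change |v| < 2 * |u + n * v|
      have h1 : |n * v| ≤ |u + n * v| + |u| := by
        simpa using abs_sub (u + n * v) u
      rw [abs_mul] at h1
      nlinarith [abs_nonneg v]
    · have hp' : |v| < 2 * |u| := hp
      have he : (g 1 ^ n) • ((u, v) : ℤ × ℤ) = (u, v + n * (4 * u)) := by
        change ((oneAddUnit lowerEnd lowerEnd_sq ^ n : (Module.End ℤ (ℤ × ℤ))ˣ) :
          Module.End ℤ (ℤ × ℤ)) (u, v) = _
        rw [coe_oneAddUnit_zpow]
        ext <;> simp [lowerEnd]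
      change (g 1 ^ n) • ((u, v) : ℤ × ℤ) ∈ {p : ℤ × ℤ | 2 * |p.1| < |p.2|}
      rw [he]
      change 2 * |u| < |v + n * (4 * u)|
      have h1 : |n * (4 * u)| ≤ |v + n * (4 * u)| + |v| := by
        simpa using abs_sub (v + n * (4 * u)) v
      rw [abs_mul, abs_mul, show |(4 : ℤ)| = 4 from rfl] at h1
      nlinarith [abs_nonneg u]
    · exact absurd rfl hij

/-! ### Elementary matrices -/

/-- The matrix unit in the upper right corner. -/
def upper (K : Type*) [CommRing K] : Matrix (Fin 2) (Fin 2) K := !![0, 1; 0, 0]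

/-- The multiple by `z` of the matrix unit in the lower left corner. -/
def lower {K : Type*} [CommRing K] (z : K) : Matrix (Fin 2) (Fin 2) K := !![0, 0; z, 0]

theorem upper_sq (K : Type*) [CommRing K] : upper K ^ 2 = 0 := by
  ext i j
  fin_cases i <;> fin_cases j <;> simp [upper, sq]

theorem lower_sq {K : Type*} [CommRing K] (z : K) : lower z ^ 2 = 0 := by
  ext i j
  fin_cases i <;> fin_cases j <;> simp [lower, sq]

/-- The homomorphism from the free group on two letters to `2 × 2` matrices that sends the letters
to the elementary matrices `[1, 1; 0, 1]` and `[1, 0; z, 1]`. -/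
def elemHom {K : Type*} [CommRing K] (z : K) :
    FreeGroup (Fin 2) →* (Matrix (Fin 2) (Fin 2) K)ˣ :=
  wordHom (upper K) (lower z) (upper_sq K) (lower_sq z)

theorem isFreePoint_iff (z : ℂ) : IsFreePoint z ↔ Function.Injective (elemHom z) := by
  have h1 : (!![1, 1; 0, 1] : Matrix (Fin 2) (Fin 2) ℂ) = 1 + upper ℂ := by
    ext i j
    fin_cases i <;> fin_cases j <;> simp [upper]
  have h2 : (!![1, 0; z, 1] : Matrix (Fin 2) (Fin 2) ℂ) = 1 + lower z := by
    ext i j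
    fin_cases i <;> fin_cases j <;> simp [lower]
  rw [IsFreePoint, h1, h2]
  exact isFreePair_iff (upper_sq ℂ) (lower_sq z)

theorem mapMatrix_upper {K L : Type*} [CommRing K] [CommRing L] (f : K →+* L) :
    f.mapMatrix (upper K) = upper L := by
  ext i j
  fin_cases i <;> fin_cases j <;> simp [upper]

theorem mapMatrix_lower {K L : Type*} [CommRing K] [CommRing L] (f : K →+* L) (z : K) :
    f.mapMatrix (lower z) = lower (f z) := by
  ext i j
  fin_cases i <;> fin_cases j <;> simp [lower]

theorem mapMatrix_elemHom {K L : Type*} [CommRing K] [CommRing L] (f : K →+* L) (z : K)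
    (w : FreeGroup (Fin 2)) :
    f.mapMatrix (elemHom z w : Matrix (Fin 2) (Fin 2) K) = elemHom (f z) w :=
  map_wordHom f.mapMatrix (upper_sq K) (lower_sq z) (upper_sq L) (lower_sq (f z)) (mapMatrix_upper f) (mapMatrix_lower f z) w

theorem map_elemHom_apply {K L : Type*} [CommRing K] [CommRing L] (f : K →+* L) (z : K)
    (w : FreeGroup (Fin 2)) (i j : Fin 2) :
    f ((elemHom z w : Matrix (Fin 2) (Fin 2) K) i j) =
      (elemHom (f z) w : Matrix (Fin 2) (Fin 2) L) i j := by
  rw [← mapMatrix_elemHom f z w]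
  rfl

theorem injective_elemHom_four : Function.Injective (elemHom (4 : ℤ)) := by
  let e : (Fin 2 → ℤ) ≃ₗ[ℤ] ℤ × ℤ := LinearEquiv.finTwoArrow ℤ ℤ
  let f : Matrix (Fin 2) (Fin 2) ℤ ≃ₐ[ℤ] Module.End ℤ (ℤ × ℤ) :=
    Matrix.toLinAlgEquiv'.trans (e.conjAlgEquiv ℤ)
  refine injective_wordHom_of_map (f : Matrix (Fin 2) (Fin 2) ℤ →+* Module.End ℤ (ℤ × ℤ)) _ _
    upperEnd_sq lowerEnd_sq ?_ ?_ injective_wordHom_end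
  · ext <;> simp [f, e, upper, upperEnd, LinearEquiv.conjAlgEquiv_apply]
  · ext <;> simp [f, e, lower, lowerEnd, LinearEquiv.conjAlgEquiv_apply]

/-- Specializing `X` to `4` proves this over `ℤ`; then `ℤ[X]` embeds in `K[X]`. -/
theorem injective_elemHom_X (K : Type*) [CommRing K] [CharZero K] :
    Function.Injective (elemHom (X : K[X])) := by
  have h : Function.Injective (elemHom (X : ℤ[X])) :=
    injective_wordHom_of_map (evalRingHom 4).mapMatrix _ _ _ _ (mapMatrix_upper _)
      (by rw [mapMatrix_lower]; simp) injective_elemHom_four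
  refine (wordHom_injective_iff_of_injective (mapRingHom (Int.castRingHom K)).mapMatrix ?_ _ _ _ _
    (mapMatrix_upper _) (by rw [mapMatrix_lower]; simp)).1 h
  exact Matrix.map_injective (map_injective _ (RingHom.injective_int _))

theorem not_isFreePoint_zero : ¬ IsFreePoint 0 := by
  rw [isFreePoint_iff]
  intro h
  have h1 : elemHom (0 : ℂ) (FreeGroup.of 1) = 1 := by
    apply Units.ext
    ext i j
    fin_cases i <;> fin_cases j <;> simp [elemHom, wordHom, coe_oneAddUnit, lower]
  exact FreeGroup.of_ne_one _ ((injective_iff_map_eq_one _).1 h _ h1)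

/-! ### Words as polynomial expressions -/

section Expansion

variable {K A : Type*} [CommRing K] [Ring A] [Algebra K A] {a b : A}

theorem mul_aeval_mul_of_mul_self_eq_zero (ha : a ^ 2 = 0) (f : K[X]) (b : A) :
    a * aeval (a * b) f = algebraMap K A (f.coeff 0) * a := by
  have h0 : a * (a * b) = 0 := by rw [← mul_assoc, ← sq, ha, zero_mul]
  nth_rewrite 1 [← divX_mul_X_add f]
  rw [mul_comm, map_add, map_mul, aeval_X, aeval_C, mul_add, ← mul_assoc, h0, zero_mul, zero_add,
    Algebra.commutes]

theorem aeval_mul_mul_of_mul_self_eq_zero (hb : b ^ 2 = 0) (f : K[X]) (a : A) :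
    aeval (a * b) f * b = algebraMap K A (f.coeff 0) * b := by
  have h0 : a * b * b = 0 := by rw [mul_assoc, ← sq, hb, mul_zero]
  nth_rewrite 1 [← divX_mul_X_add f]
  rw [map_add, map_mul, aeval_X, aeval_C, add_mul, mul_assoc, h0, mul_zero, zero_add]

theorem mul_mul_eq_zero_of_mul_eq_zero {x y : A} (h : x * y = 0) (z : A) : x * (y * z) = 0 := by
  rw [← mul_assoc, h, zero_mul]

/-- The element of an algebra that corresponds to the matrix `[1 + Xp, q; Xr, 1 + Xs]`. -/
noncomputable def expand (a b : A) (p q r s : K[X]) : A :=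
  1 + aeval (a * b) (X * p) + aeval (a * b) q * a + b * aeval (a * b) r +
    b * aeval (a * b) s * a

/-- The right-hand side is matrix multiplication. Each product of two terms either vanishes through
`a² = 0` or `b² = 0`, or merges, an inner `a * b` contributing a factor `X`. -/
theorem expand_mul (ha : a ^ 2 = 0) (hb : b ^ 2 = 0) (p q r s p' q' r' s' : K[X]) :
    expand a b p q r s * expand a b p' q' r' s' =
      expand a b (p + p' + X * p * p' + q * r') (q + q' + X * (p * q' + q * s'))
        (r + r' + X * (r * p' + s * r')) (s + s' + r * q' + X * s * s') := by
  have haa : a * a = 0 := by rw [← sq, ha]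
  have hbb : b * b = 0 := by rw [← sq, hb]
  have ac : a * (a * b) = 0 := by rw [← mul_assoc, haa, zero_mul]
  have cb : a * b * b = 0 := by rw [mul_assoc, hbb, mul_zero]
  have afa (f : K[X]) : a * aeval (a * b) f * a = 0 := by
    rw [mul_aeval_mul_of_mul_self_eq_zero ha, mul_assoc, haa, mul_zero]
  have bfb (f : K[X]) : b * aeval (a * b) f * b = 0 := by
    rw [mul_assoc, aeval_mul_mul_of_mul_self_eq_zero hb, ← mul_assoc, ← Algebra.commutes,
      mul_assoc, hbb, mul_zero]
  have acf (f : K[X]) : a * aeval (a * b) (X * f) = 0 := by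
    rw [map_mul, aeval_X, ← mul_assoc, ac, zero_mul]
  have cfb (f : K[X]) : aeval (a * b) (X * f) * b = 0 := by
    rw [mul_comm X f, map_mul, aeval_X, mul_assoc, cb, mul_zero]
  have hab (f g : K[X]) : aeval (a * b) f * a * (b * aeval (a * b) g) =
      aeval (a * b) (X * (f * g)) := by
    have : aeval (a * b) f * a * (b * aeval (a * b) g) =
        aeval (a * b) f * aeval (a * b) (X : K[X]) * aeval (a * b) g := by
      rw [aeval_X]
      noncomm_ring
    rw [this, ← map_mul, ← map_mul]
    congr 1
    ring
  have e11 : aeval (a * b) (X * p) * aeval (a * b) (X * p') =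
      aeval (a * b) (X * (X * p * p')) := by
    rw [← map_mul]
    congr 1
    ring
  have e12 : aeval (a * b) (X * p) * (aeval (a * b) q' * a) =
      aeval (a * b) (X * (p * q')) * a := by
    rw [← mul_assoc, ← map_mul, mul_assoc]
  have e13 : aeval (a * b) (X * p) * (b * aeval (a * b) r') = 0 := by
    rw [← mul_assoc, cfb, zero_mul]
  have e14 : aeval (a * b) (X * p) * (b * aeval (a * b) s' * a) = 0 := by
    rw [← mul_assoc, ← mul_assoc, cfb, zero_mul, zero_mul]
  have e21 : aeval (a * b) q * a * aeval (a * b) (X * p') = 0 := by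
    rw [mul_assoc, acf, mul_zero]
  have e22 : aeval (a * b) q * a * (aeval (a * b) q' * a) = 0 := by
    rw [mul_assoc, ← mul_assoc a, afa, mul_zero]
  have e24 : aeval (a * b) q * a * (b * aeval (a * b) s' * a) =
      aeval (a * b) (X * (q * s')) * a := by
    rw [← mul_assoc, hab]
  have e31 : b * aeval (a * b) r * aeval (a * b) (X * p') =
      b * aeval (a * b) (X * (r * p')) := by
    rw [mul_assoc, ← map_mul]
    congr 2
    ring
  have e32 : b * aeval (a * b) r * (aeval (a * b) q' * a) =
      b * aeval (a * b) (r * q') * a := by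
    rw [← mul_assoc, mul_assoc b, ← map_mul]
  have e33 : b * aeval (a * b) r * (b * aeval (a * b) r') = 0 := by
    rw [← mul_assoc, bfb, zero_mul]
  have e34 : b * aeval (a * b) r * (b * aeval (a * b) s' * a) = 0 := by
    rw [← mul_assoc, ← mul_assoc, bfb, zero_mul, zero_mul]
  have e41 : b * aeval (a * b) s * a * aeval (a * b) (X * p') = 0 := by
    rw [mul_assoc, acf, mul_zero]
  have e42 : b * aeval (a * b) s * a * (aeval (a * b) q' * a) = 0 := by
    rw [mul_assoc, ← mul_assoc a, afa, mul_zero]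
  have e43 : b * aeval (a * b) s * a * (b * aeval (a * b) r') =
      b * aeval (a * b) (X * (s * r')) := by
    rw [mul_assoc b, mul_assoc b, hab]
  have e44 : b * aeval (a * b) s * a * (b * aeval (a * b) s' * a) =
      b * aeval (a * b) (X * s * s') * a := by
    rw [← mul_assoc, mul_assoc b, mul_assoc b, hab]
    congr 3
    ring
  simp only [expand, mul_add, add_mul, e11, e12, e13, e14, e21, e22, hab, e24, e31, e32, e33, e34,
    e41, e42, e43, e44, map_add, one_mul, mul_one]
  abel

theorem exists_expansion (ha : a ^ 2 = 0) (hb : b ^ 2 = 0) (w : FreeGroup (Fin 2)) :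
    ∃ p q r s : K[X],
      (elemHom (X : K[X]) w : Matrix (Fin 2) (Fin 2) K[X]) =
        !![1 + X * p, q; X * r, 1 + X * s] ∧
      (wordHom a b ha hb w : A) = expand a b p q r s := by
  induction w using FreeGroup.induction_on with
  | C1 =>
    refine ⟨0, 0, 0, 0, ?_, ?_⟩
    · simp [Matrix.one_fin_two]
    · simp [expand]
  | of i =>
    fin_cases i
    · refine ⟨0, 1, 0, 0, ?_, ?_⟩
      · simp [elemHom, wordHom, coe_oneAddUnit, Matrix.one_fin_two, upper]
      · simp [expand, wordHom, coe_oneAddUnit]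
    · refine ⟨0, 0, 1, 0, ?_, ?_⟩
      · simp [elemHom, wordHom, coe_oneAddUnit, Matrix.one_fin_two, lower]
      · simp [expand, wordHom, coe_oneAddUnit]
  | inv_of i _ =>
    fin_cases i
    · refine ⟨0, -1, 0, 0, ?_, ?_⟩
      · simp [elemHom, wordHom, coe_inv_oneAddUnit, Matrix.one_fin_two, upper]
      · simp [expand, wordHom, coe_inv_oneAddUnit, sub_eq_add_neg]
    · refine ⟨0, 0, -1, 0, ?_, ?_⟩
      · ext i j
        fin_cases i <;> fin_cases j <;> simp [elemHom, wordHom, coe_inv_oneAddUnit, lower]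
      · simp [expand, wordHom, coe_inv_oneAddUnit, sub_eq_add_neg]
  | mul x y hx hy =>
    obtain ⟨p, q, r, s, hM, hA⟩ := hx
    obtain ⟨p', q', r', s', hM', hA'⟩ := hy
    refine ⟨_, _, _, _, ?_, by rw [map_mul, Units.val_mul, hA, hA', expand_mul ha hb]⟩
    rw [map_mul, Units.val_mul, hM, hM', Matrix.mul_fin_two]
    congr 1
    ring_nf

/-- The four terms of the expansion need not be independent in `A`. Multiplying by `c` or `a` on the
left and by `c` or `b` on the right isolates each coefficient `f` as `c f(c) c = 0`, at the cost of
`X²`. -/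
theorem aeval_X_sq_mul_eq_zero_of_wordHom_eq_one (ha : a ^ 2 = 0) (hb : b ^ 2 = 0)
    {w : FreeGroup (Fin 2)} (hw : wordHom a b ha hb w = 1) (i j : Fin 2) :
    aeval (a * b) (X ^ 2 *
      ((elemHom (X : K[X]) w : Matrix (Fin 2) (Fin 2) K[X]) - 1) i j) = 0 := by
  obtain ⟨p, q, r, s, hM, hA⟩ := exists_expansion (K := K) ha hb w
  rw [hM]
  rw [hw, Units.val_one] at hA
  have haa : a * a = 0 := by rw [← sq, ha]
  have hbb : b * b = 0 := by rw [← sq, hb]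
  have hE : aeval (a * b) (X * p) + aeval (a * b) q * a + b * aeval (a * b) r +
      b * aeval (a * b) s * a = 0 := by
    rw [expand, add_assoc, add_assoc, add_assoc, left_eq_add] at hA
    rw [← hA]
    abel
  have afa (f : K[X]) : a * aeval (a * b) f * a = 0 := by
    rw [mul_aeval_mul_of_mul_self_eq_zero ha, mul_assoc, haa, mul_zero]
  have bfb (f : K[X]) : b * aeval (a * b) f * b = 0 := by
    rw [mul_assoc, aeval_mul_mul_of_mul_self_eq_zero hb, ← mul_assoc, ← Algebra.commutes,
      mul_assoc, hbb, mul_zero]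
  have hc (f : K[X]) (h : a * b * aeval (a * b) f * (a * b) = 0) :
      aeval (a * b) (X ^ 2 * f) = 0 := by
    rw [← h, show X ^ 2 * f = X * f * X by ring, map_mul, map_mul, aeval_X]
  have key (x y : A) : x * aeval (a * b) (X * p) * y + x * aeval (a * b) q * a * y +
      x * b * aeval (a * b) r * y + x * b * aeval (a * b) s * a * y = 0 := by
    have := congrArg (fun t => x * t * y) hE
    simpa only [mul_add, add_mul, ← mul_assoc, mul_zero, zero_mul] using this
  have hp : aeval (a * b) (X ^ 2 * (X * p)) = 0 := by
    apply hc
    have := key (a * b) (a * b)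
    simpa only [mul_assoc, haa, hbb, mul_mul_eq_zero_of_mul_eq_zero haa, mul_mul_eq_zero_of_mul_eq_zero hbb, mul_zero, zero_mul,
      add_zero] using this
  have hq : aeval (a * b) (X ^ 2 * q) = 0 := by
    apply hc
    have := key (a * b) b
    have h1 : a * b * aeval (a * b) (X * p) * b = 0 := by
      rw [mul_assoc a, mul_assoc a, bfb, mul_zero]
    rw [h1, zero_add] at this
    simpa only [mul_assoc, haa, hbb, mul_mul_eq_zero_of_mul_eq_zero haa, mul_mul_eq_zero_of_mul_eq_zero hbb, mul_zero, zero_mul,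
      add_zero] using this
  have hr : aeval (a * b) (X ^ 2 * r) = 0 := by
    apply hc
    have := key a (a * b)
    have h1 : a * aeval (a * b) (X * p) * (a * b) = 0 := by
      rw [← mul_assoc, afa, zero_mul]
    rw [h1, zero_add] at this
    simpa only [mul_assoc, haa, hbb, mul_mul_eq_zero_of_mul_eq_zero haa, mul_mul_eq_zero_of_mul_eq_zero hbb, mul_zero, zero_mul,
      add_zero, zero_add] using this
  have hs : aeval (a * b) (X ^ 2 * s) = 0 := by
    apply hc
    have := key a b
    have h1 : a * aeval (a * b) (X * p) * b = 0 := by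
      rw [map_mul, aeval_X, ← mul_assoc, ← mul_assoc, haa, zero_mul, zero_mul, zero_mul]
    have h2 : a * b * aeval (a * b) r * b = 0 := by
      rw [mul_assoc a, mul_assoc a, bfb, mul_zero]
    rw [h1, h2, afa, zero_mul, zero_add, zero_add, zero_add] at this
    simpa only [mul_assoc] using this
  have hX (f : K[X]) (h : aeval (a * b) (X ^ 2 * f) = 0) :
      aeval (a * b) (X ^ 2 * (X * f)) = 0 := by
    rw [mul_left_comm, map_mul, h, mul_zero]
  fin_cases i <;> fin_cases j
  · simpa using hp
  · simpa using hq
  · simpa using hX r hr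
  · simpa using hX s hs

/-- The factor `X` beside `m` pays for the `X` in three of the matrix entries, so that `m` divides
`p`, `r` and `s` themselves. -/
theorem wordHom_eq_one_of_dvd (ha : a ^ 2 = 0) (hb : b ^ 2 = 0) {w : FreeGroup (Fin 2)} {m : K[X]}
    (hm : aeval (a * b) m = 0)
    (hw : ∀ i j, X * m ∣ ((elemHom (X : K[X]) w : Matrix (Fin 2) (Fin 2) K[X]) - 1) i j) :
    wordHom a b ha hb w = 1 := by
  obtain ⟨p, q, r, s, hM, hA⟩ := exists_expansion (K := K) ha hb w
  rw [hM] at hw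
  have h0 (f : K[X]) (h : m ∣ f) : aeval (a * b) f = 0 := by
    obtain ⟨g, rfl⟩ := h
    rw [map_mul, hm, zero_mul]
  have hX (f : K[X]) (h : X * m ∣ X * f) : aeval (a * b) f = 0 := by
    obtain ⟨g, hg⟩ := h
    rw [mul_assoc] at hg
    exact h0 f ⟨g, isRegular_X.left hg⟩
  have hp : aeval (a * b) p = 0 := hX p (by simpa using hw 0 0)
  have hq : aeval (a * b) q = 0 := h0 q ((dvd_mul_left m X).trans (by simpa using hw 0 1))
  have hr : aeval (a * b) r = 0 := hX r (by simpa using hw 1 0)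
  have hs : aeval (a * b) s = 0 := hX s (by simpa using hw 1 1)
  apply Units.ext
  rw [hA, expand, map_mul, hp, hq, hr, hs]
  simp

end Expansion

/-! ### Commutation in the free group of rank two -/

theorem det_elemHom {K : Type*} [CommRing K] (z : K) (w : FreeGroup (Fin 2)) :
    (elemHom z w : Matrix (Fin 2) (Fin 2) K).det = 1 := by
  have h : (Units.map (Matrix.detMonoidHom (n := Fin 2) (R := K))).comp (elemHom z) = 1 := by
    refine FreeGroup.ext_hom _ _ fun i => Units.ext ?_
    fin_cases i <;>
      simp [elemHom, wordHom, coe_oneAddUnit, Matrix.det_fin_two, upper, lower]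
  exact congrArg Units.val (DFunLike.congr_fun h w)

/-- Determinant one leaves only `1` and `-1`, and the diagonal entries equal `1` at `X = 0`. -/
theorem eq_one_of_elemHom_scalar {w : FreeGroup (Fin 2)}
    (h01 : (elemHom (X : ℤ[X]) w : Matrix (Fin 2) (Fin 2) ℤ[X]) 0 1 = 0)
    (h10 : (elemHom (X : ℤ[X]) w : Matrix (Fin 2) (Fin 2) ℤ[X]) 1 0 = 0)
    (h : (elemHom (X : ℤ[X]) w : Matrix (Fin 2) (Fin 2) ℤ[X]) 0 0 =
      (elemHom (X : ℤ[X]) w : Matrix (Fin 2) (Fin 2) ℤ[X]) 1 1) : w = 1 := by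
  obtain ⟨p, q, r, s, hM, -⟩ :=
    -- Only the shape of the matrix is needed, so `a = b = 0` suffices.
    exists_expansion (K := ℤ) (A := ℤ) (a := 0) (b := 0) (by simp) (by simp) w
  have hdet := det_elemHom (X : ℤ[X]) w
  rw [Matrix.det_fin_two, h01, zero_mul, sub_zero, ← h] at hdet
  have h00 : (elemHom (X : ℤ[X]) w : Matrix (Fin 2) (Fin 2) ℤ[X]) 0 0 = 1 := by
    have hp : (elemHom (X : ℤ[X]) w : Matrix (Fin 2) (Fin 2) ℤ[X]) 0 0 = 1 + X * p := by
      rw [hM]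
      rfl
    rcases mul_self_eq_one_iff.1 hdet with h1 | h1
    · exact h1
    · rw [hp] at h1
      have := congrArg (eval 0) h1
      norm_num at this
  refine (injective_iff_map_eq_one _).1 (injective_elemHom_X ℤ) w (Units.ext ?_)
  ext1 i j
  fin_cases i <;> fin_cases j
  · exact h00
  · exact h01
  · exact h10
  · exact h ▸ h00

theorem commute_fin_two {K : Type*} [CommRing K] {M N : Matrix (Fin 2) (Fin 2) K}
    (h : Commute M N) :
    M 0 1 * N 1 0 = M 1 0 * N 0 1 ∧ (M 0 0 - M 1 1) * N 0 1 = (N 0 0 - N 1 1) * M 0 1 ∧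
      (M 0 0 - M 1 1) * N 1 0 = (N 0 0 - N 1 1) * M 1 0 := by
  have e (i j : Fin 2) := congrFun (congrFun h.eq i) j
  simp only [Matrix.mul_apply, Fin.sum_univ_two] at e
  refine ⟨?_, ?_, ?_⟩
  · linear_combination e 0 0
  · linear_combination e 0 1
  · linear_combination - e 1 0

/-- A nonscalar matrix over `ℤ[X]` that commutes with `N` and with its conjugates by the two
generators forces `N` to be scalar; `g` can be `1` or a generator. -/
theorem exists_not_commute_conj {u w : FreeGroup (Fin 2)} (hu : u ≠ 1) (hw : w ≠ 1) :
    ∃ g, ¬ Commute u (g * w * g⁻¹) := by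
  by_contra! hall
  have hM (g) : Commute (elemHom (X : ℤ[X]) u : Matrix (Fin 2) (Fin 2) ℤ[X])
      (elemHom (X : ℤ[X]) (g * w * g⁻¹)) := by
    have := (hall g).map ((Units.coeHom _).comp (elemHom (X : ℤ[X])))
    exact this
  have h1 := hM 1
  have hx := hM (FreeGroup.of 0)
  have hy := hM (FreeGroup.of 1)
  rw [one_mul, inv_one, mul_one] at h1
  simp only [map_mul, map_inv, Units.val_mul] at hx hy
  have hu' := fun h01 h10 h => hu (eq_one_of_elemHom_scalar (w := u) h01 h10 h)
  have hw' := fun h01 h10 h => hw (eq_one_of_elemHom_scalar (w := w) h01 h10 h)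
  generalize (elemHom (X : ℤ[X]) u : Matrix (Fin 2) (Fin 2) ℤ[X]) = M at *
  generalize (elemHom (X : ℤ[X]) w : Matrix (Fin 2) (Fin 2) ℤ[X]) = N at *
  have ex : (elemHom (X : ℤ[X]) (FreeGroup.of 0) : Matrix (Fin 2) (Fin 2) ℤ[X]) =
      !![1, 1; 0, 1] := by
    ext1 i j
    fin_cases i <;> fin_cases j <;> simp [elemHom, wordHom, coe_oneAddUnit, upper]
  have ex' : ((elemHom (X : ℤ[X]) (FreeGroup.of 0))⁻¹.val : Matrix (Fin 2) (Fin 2) ℤ[X]) =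
      !![1, -1; 0, 1] := by
    ext1 i j
    fin_cases i <;> fin_cases j <;> simp [elemHom, wordHom, coe_inv_oneAddUnit, upper]
  have ey : (elemHom (X : ℤ[X]) (FreeGroup.of 1) : Matrix (Fin 2) (Fin 2) ℤ[X]) =
      !![1, 0; X, 1] := by
    ext1 i j
    fin_cases i <;> fin_cases j <;> simp [elemHom, wordHom, coe_oneAddUnit, lower]
  have ey' : ((elemHom (X : ℤ[X]) (FreeGroup.of 1))⁻¹.val : Matrix (Fin 2) (Fin 2) ℤ[X]) =
      !![1, 0; -X, 1] := by
    ext1 i j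
    fin_cases i <;> fin_cases j <;> simp [elemHom, wordHom, coe_inv_oneAddUnit, lower]
  rw [ex, ex'] at hx
  rw [ey, ey'] at hy
  rw [Matrix.eta_fin_two N, Matrix.mul_fin_two, Matrix.mul_fin_two] at hx hy
  obtain ⟨a1, a2, a3⟩ := commute_fin_two h1
  obtain ⟨b1, b2, b3⟩ := commute_fin_two hx
  obtain ⟨c1, c2, -⟩ := commute_fin_two hy
  simp only [Matrix.of_apply, Matrix.cons_val', Matrix.cons_val_zero, Matrix.cons_val_one,
    Matrix.cons_val_fin_one] at b1 b2 b3 c1 c2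
  have hX : (X : ℤ[X]) ≠ 0 := X_ne_zero
  have h2 : (2 : ℤ[X]) ≠ 0 := two_ne_zero
  by_cases hM10 : M 1 0 = 0
  · by_cases hM01 : M 0 1 = 0
    · have hd : M 0 0 - M 1 1 ≠ 0 := fun h => hu' hM01 hM10 (sub_eq_zero.1 h)
      have hN01 : N 0 1 = 0 := by
        rw [hM01, mul_zero] at a2
        exact (mul_eq_zero.1 a2).resolve_left hd
      have hN10 : N 1 0 = 0 := by
        rw [hM10, mul_zero] at a3
        exact (mul_eq_zero.1 a3).resolve_left hd
      refine hw' hN01 hN10 (sub_eq_zero.1 ((mul_eq_zero.1 ?_).resolve_left hd))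
      rw [hM01, hN01, hN10] at b2
      linear_combination -b2
    · have hN10 : N 1 0 = 0 := by
        rw [hM10, zero_mul] at a1
        exact (mul_eq_zero.1 a1).resolve_left hM01
      have hN01 : N 0 1 = 0 := by
        have : 2 * X * M 0 1 * N 0 1 = 0 := by linear_combination c2 - a2
        exact (mul_eq_zero.1 this).resolve_left (mul_ne_zero (mul_ne_zero h2 hX) hM01)
      refine hw' hN01 hN10 (sub_eq_zero.1 ((mul_eq_zero.1 ?_).resolve_left (mul_ne_zero hX hM01)))
      rw [hM10, hN01, hN10] at c1
      linear_combination c1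
  · have hN10 : N 1 0 = 0 := by
      -- Conjugation by the upper generator keeps `N 1 0` and adds `2 * N 1 0` to `N 0 0 - N 1 1`;
      -- subtracting the two commutation relations isolates this change.
      have : 2 * M 1 0 * N 1 0 = 0 := by linear_combination a3 - b3
      exact (mul_eq_zero.1 this).resolve_left (mul_ne_zero h2 hM10)
    have hN01 : N 0 1 = 0 := by
      rw [hN10, mul_zero] at a1
      exact (mul_eq_zero.1 a1.symm).resolve_left hM10
    refine hw' hN01 hN10 (sub_eq_zero.1 ((mul_eq_zero.1 ?_).resolve_left hM10))
    rw [hN10, hN01] at b1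
    linear_combination b1

/-! ### Words congruent to the identity -/

/-- Congruences to the identity modulo `f` and modulo `g` give one modulo `f g` for the commutator,
so multiplicities are handled one root at a time. -/
theorem exists_word_congr (s : Multiset ℂ) (hs : ∀ z ∈ s, ¬ IsFreePoint z) :
    ∃ w : FreeGroup (Fin 2), w ≠ 1 ∧ ∀ i j, (s.map fun z => X - C z).prod ∣
      ((elemHom (X : ℂ[X]) w : Matrix (Fin 2) (Fin 2) ℂ[X]) - 1) i j := by
  induction s using Multiset.induction_on with
  | empty => exact ⟨FreeGroup.of 0, FreeGroup.of_ne_one _, fun i j => by simp⟩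
  | cons z s ih =>
    obtain ⟨u, hu, hug⟩ := ih fun z hz => hs z (Multiset.mem_cons_of_mem hz)
    obtain ⟨w, hwz, hw⟩ : ∃ w, elemHom z w = 1 ∧ w ≠ 1 := by
      have := hs z (Multiset.mem_cons_self z s)
      rw [isFreePoint_iff, injective_iff_map_eq_one] at this
      push Not at this
      exact this
    obtain ⟨g, hg⟩ := exists_not_commute_conj hu hw
    -- Conjugating by `g` keeps `w` trivial at `z` and makes the commutator nontrivial.
    refine ⟨u * (g * w * g⁻¹) * u⁻¹ * (g * w * g⁻¹)⁻¹, ?_, ?_⟩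
    · intro h
      exact hg (commutatorElement_eq_one_iff_commute.1 h)
    have hv : elemHom z (g * w * g⁻¹) = 1 := by
      rw [map_mul, map_mul, hwz, mul_one, map_inv, mul_inv_cancel]
    generalize g * w * g⁻¹ = v at hv
    have hvg (i j) : X - C z ∣
        ((elemHom (X : ℂ[X]) v : Matrix (Fin 2) (Fin 2) ℂ[X]) - 1) i j := by
      rw [dvd_iff_isRoot, IsRoot, Matrix.sub_apply, eval_sub, sub_eq_zero]
      have := map_elemHom_apply (evalRingHom z) X v i j
      rw [coe_evalRingHom, eval_X, hv] at this
      rw [this]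
      simp only [Units.val_one, Matrix.one_apply]
      split_ifs <;> simp
    -- `UVU⁻¹V⁻¹ - 1 = (UV - VU)U⁻¹V⁻¹`, and `UV - VU` is unchanged when `1` is subtracted from `U`
    -- and `V`.
    have hcomm : (elemHom (X : ℂ[X]) (u * v * u⁻¹ * v⁻¹) : Matrix (Fin 2) (Fin 2) ℂ[X]) - 1 =
        ((elemHom (X : ℂ[X]) u - 1) * (elemHom (X : ℂ[X]) v - 1) -
          (elemHom (X : ℂ[X]) v - 1) * (elemHom (X : ℂ[X]) u - 1)) *
          ((elemHom (X : ℂ[X]) u)⁻¹.val * (elemHom (X : ℂ[X]) v)⁻¹.val) := by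
      simp only [map_mul, map_inv, Units.val_mul]
      have e : ((elemHom (X : ℂ[X]) u - 1 : Matrix (Fin 2) (Fin 2) ℂ[X]) *
          (elemHom (X : ℂ[X]) v - 1) -
          (elemHom (X : ℂ[X]) v - 1) * (elemHom (X : ℂ[X]) u - 1)) =
          elemHom (X : ℂ[X]) u * elemHom (X : ℂ[X]) v -
            elemHom (X : ℂ[X]) v * elemHom (X : ℂ[X]) u := by noncomm_ring
      rw [e, sub_mul]
      simp [mul_assoc]
    intro i j
    rw [hcomm, Multiset.map_cons, Multiset.prod_cons, Matrix.mul_apply]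
    refine Finset.dvd_sum fun k _ => Dvd.dvd.mul_right ?_ _
    rw [Matrix.sub_apply, Matrix.mul_apply, Matrix.mul_apply]
    refine dvd_sub (Finset.dvd_sum fun l _ => ?_) (Finset.dvd_sum fun l _ => ?_)
    · rw [mul_comm (X - C z)]
      exact mul_dvd_mul (hug _ _) (hvg _ _)
    · exact mul_dvd_mul (hvg _ _) (hug _ _)

/-! ### Eigenvalues and free pairs in complex algebras -/

/-- Write the minimal polynomial as `(X - z) q`; by minimality `q(c) ≠ 0`, and it is an eigenvector.
-/
theorem isEigenvalueOf_of_isRoot_minpoly {A : Type*} [Ring A] [Algebra ℂ A] {c : A}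
    (hc : IsIntegral ℂ c) {z : ℂ} (hz : (minpoly ℂ c).IsRoot z) : IsEigenvalueOf c z := by
  obtain ⟨q, hq⟩ := dvd_iff_isRoot.2 hz
  have hq0 : q ≠ 0 := by
    rintro rfl
    exact minpoly.ne_zero hc (by rw [hq, mul_zero])
  have hqc : aeval c q ≠ 0 := by
    intro h0
    have h1 := natDegree_le_of_dvd (minpoly.dvd ℂ c h0) hq0
    rw [hq, natDegree_mul (X_sub_C_ne_zero z) hq0, natDegree_X_sub_C] at h1
    omega
  refine Module.End.hasEigenvalue_of_hasEigenvector (x := aeval c q)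
    ⟨Module.End.mem_eigenspace_iff.2 ?_, hqc⟩
  have h := minpoly.aeval ℂ c
  rw [hq, map_mul, map_sub, aeval_X, aeval_C, sub_mul, sub_eq_zero] at h
  rw [LinearMap.mulLeft_apply, h, Algebra.smul_def]

theorem eval_eq_zero_of_isEigenvalueOf {A : Type*} [Ring A] [Algebra ℂ A] {c : A} {z : ℂ}
    (hz : IsEigenvalueOf c z) {f : ℂ[X]} (hf : aeval c f = 0) : f.eval z = 0 := by
  obtain ⟨v, hv⟩ := Module.End.HasEigenvalue.exists_hasEigenvector hz
  have h := Module.End.aeval_apply_of_hasEigenvector (p := f) hv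
  have h2 : aeval (LinearMap.mulLeft ℂ c) f = LinearMap.mulLeft ℂ (aeval c f) :=
    aeval_algHom_apply (Algebra.lmul ℂ A) c f
  rw [h2, hf, LinearMap.mulLeft_apply, zero_mul] at h
  exact (smul_eq_zero.1 h.symm).resolve_right hv.2

theorem injective_wordHom_of_transcendental {A : Type*} [Ring A] [Algebra ℚ A] {a b : A}
    (ha : a ^ 2 = 0) (hb : b ^ 2 = 0) (hc : Transcendental ℚ (a * b)) :
    Function.Injective (wordHom a b ha hb) := by
  rw [injective_iff_map_eq_one]
  refine fun w hw => (injective_iff_map_eq_one _).1 (injective_elemHom_X ℚ) w (Units.ext ?_)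
  rw [Units.val_one, ← sub_eq_zero]
  ext1 i j
  have h := aeval_X_sq_mul_eq_zero_of_wordHom_eq_one (K := ℚ) ha hb hw i j
  have h0 := (transcendental_iff.1 hc) _ h
  exact (mul_eq_zero.1 h0).resolve_left (pow_ne_zero 2 X_ne_zero)

theorem injective_wordHom_of_isFreePoint {A : Type*} [Ring A] [Algebra ℂ A] {a b : A}
    (ha : a ^ 2 = 0) (hb : b ^ 2 = 0) {z : ℂ} (hz : IsEigenvalueOf (a * b) z)
    (hf : IsFreePoint z) : Function.Injective (wordHom a b ha hb) := by
  have hz0 : z ≠ 0 := by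
    rintro rfl
    exact not_isFreePoint_zero hf
  rw [injective_iff_map_eq_one]
  rw [isFreePoint_iff, injective_iff_map_eq_one] at hf
  refine fun w hw => hf w (Units.ext ?_)
  ext1 i j
  have h := eval_eq_zero_of_isEigenvalueOf hz
    (aeval_X_sq_mul_eq_zero_of_wordHom_eq_one (K := ℂ) ha hb hw i j)
  rw [eval_mul, eval_pow, eval_X, Matrix.sub_apply, eval_sub] at h
  have h1 := (mul_eq_zero.1 h).resolve_left (pow_ne_zero 2 hz0)
  have h2 := map_elemHom_apply (evalRingHom z) X w i j
  rw [coe_evalRingHom, eval_X] at h2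
  rw [← h2, sub_eq_zero.1 h1, Units.val_one]
  simp only [Matrix.one_apply]
  split_ifs <;> simp

theorem exists_isFreePoint_of_injective_wordHom {A : Type*} [Ring A] [Algebra ℂ A] {a b : A}
    (ha : a ^ 2 = 0) (hb : b ^ 2 = 0) (hc : IsIntegral ℂ (a * b))
    (h : Function.Injective (wordHom a b ha hb)) :
    ∃ z, IsEigenvalueOf (a * b) z ∧ IsFreePoint z := by
  by_contra! hn
  -- The added root `0` supplies the factor `X` required by `wordHom_eq_one_of_dvd`.
  obtain ⟨w, hw, hd⟩ := exists_word_congr (0 ::ₘ (minpoly ℂ (a * b)).roots) fun z hz => by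
    rcases Multiset.mem_cons.1 hz with rfl | hz
    · exact not_isFreePoint_zero
    · exact hn z (isEigenvalueOf_of_isRoot_minpoly hc (isRoot_of_mem_roots hz))
  refine hw ((injective_iff_map_eq_one _).1 h w
    (wordHom_eq_one_of_dvd ha hb (minpoly.aeval ℂ (a * b)) ?_))
  have hprod := (IsAlgClosed.splits (minpoly ℂ (a * b))).eq_prod_roots_of_monic (minpoly.monic hc)
  rw [Multiset.map_cons, Multiset.prod_cons, C_0, sub_zero, ← hprod] at hd
  exact hd

theorem isFreePair_iff_of_complexAlgebra {A : Type*} [Ring A] [Algebra ℚ A] [Algebra ℂ A] {a b : A}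
    (ha : a ^ 2 = 0) (hb : b ^ 2 = 0) :
    Function.Injective (wordHom a b ha hb) ↔ Transcendental ℚ (a * b) ∨
      (IsAlgebraic ℚ (a * b) ∧ ∃ z : ℂ, IsEigenvalueOf (a * b) z ∧ IsFreePoint z) := by
  constructor
  · intro h
    by_cases hc : IsAlgebraic ℚ (a * b)
    · exact Or.inr ⟨hc, exists_isFreePoint_of_injective_wordHom ha hb
        (hc.isIntegral.tower_top (A := ℂ)) h⟩
    · exact Or.inl hc
  · rintro (h | ⟨-, z, hz, hf⟩)
    · exact injective_wordHom_of_transcendental ha hb h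
    · exact injective_wordHom_of_isFreePoint ha hb hz hf

/-! ### Torsion -/

/-- Each conjugate of `(1 + a)^n` has the form `1 + n y`. Since `n` kills `w - 1`, the word commutes
with all of them, impossible in a free group unless `w = 1`. -/
theorem eq_one_of_zsmul_eq_zero {R : Type*} [Ring R] {a b : R} (ha : a ^ 2 = 0) (hb : b ^ 2 = 0)
    (h : Function.Injective (wordHom a b ha hb)) {w : FreeGroup (Fin 2)} {n : ℤ} (hn : n ≠ 0)
    (hw : n • ((wordHom a b ha hb w : R) - 1) = 0) : w = 1 := by
  by_contra hw1
  have hx : (FreeGroup.of 0 : FreeGroup (Fin 2)) ^ n ≠ 1 := by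
    intro h0
    exact FreeGroup.of_ne_one (0 : Fin 2) ((IsMulTorsionFree.zpow_eq_one_iff_left hn).1 h0)
  obtain ⟨g, hg⟩ := exists_not_commute_conj hw1 hx
  refine hg (h (Units.ext ?_))
  have e : (wordHom a b ha hb (g * FreeGroup.of 0 ^ n * g⁻¹) : R) =
      1 + n • ((wordHom a b ha hb g : R) * a * ((wordHom a b ha hb g)⁻¹ : Rˣ)) := by
    have e0 : wordHom a b ha hb (FreeGroup.of 0) = oneAddUnit a ha := by simp [wordHom]
    simp only [map_mul, map_zpow, map_inv, Units.val_mul, e0, coe_oneAddUnit_zpow]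
    rw [mul_add, add_mul, mul_one, Units.mul_inv, zsmul_eq_mul, ← mul_assoc, ← mul_assoc,
      ← mul_assoc, Int.cast_comm n]
  rw [map_mul, map_mul _ _ w, Units.val_mul, Units.val_mul, e]
  generalize (wordHom a b ha hb g : R) * a * ((wordHom a b ha hb g)⁻¹ : Rˣ) = y
  obtain ⟨t, ht⟩ : ∃ t, (wordHom a b ha hb w : R) = 1 + t := ⟨_, (add_sub_cancel _ _).symm⟩
  rw [ht, add_sub_cancel_left] at hw
  rw [ht]
  have h1 : t * (n • y) = 0 := by rw [mul_smul_comm, ← smul_mul_assoc, hw, zero_mul]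
  have h2 : n • y * t = 0 := by rw [smul_mul_assoc, ← mul_smul_comm, hw, mul_zero]
  simp only [add_mul, mul_add, one_mul, mul_one, h1, h2]
  abel

/-- Modulo torsion `M` is torsion-free, hence flat over `ℤ`, so tensoring it with `ℤ → ℂ` stays
injective. -/
theorem exists_zsmul_eq_zero_of_one_tmul_eq_zero {M : Type*} [AddCommGroup M] {x : M}
    (hx : (1 : ℂ) ⊗ₜ[ℤ] x = 0) : ∃ n : ℤ, n ≠ 0 ∧ n • x = 0 := by
  let T := Submodule.torsion ℤ M
  have hinj : Function.Injective
      (LinearMap.rTensor (M ⧸ T) (Algebra.linearMap ℤ ℂ)) :=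
    Module.Flat.rTensor_preserves_injective_linearMap _ (RingHom.injective_int (algebraMap ℤ ℂ))
  have h1 : (1 : ℤ) ⊗ₜ[ℤ] T.mkQ x = 0 := by
    apply hinj
    have := congrArg (LinearMap.lTensor ℂ T.mkQ) hx
    simpa using this
  have h2 : T.mkQ x = 0 := by
    simpa using congrArg (TensorProduct.lid ℤ (M ⧸ T)) h1
  rw [Submodule.mkQ_apply, Submodule.Quotient.mk_eq_zero] at h2
  obtain ⟨n, hn⟩ := (Submodule.mem_torsion_iff _).1 h2
  exact ⟨n, nonZeroDivisors.coe_ne_zero n, hn⟩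

theorem wordHom_injective_iff_tensor {R : Type*} [Ring R] {a b : R} (ha : a ^ 2 = 0)
    (hb : b ^ 2 = 0) {a' b' : ℂ ⊗[ℤ] R} (ha' : a' ^ 2 = 0) (hb' : b' ^ 2 = 0)
    (haa : 1 ⊗ₜ a = a') (hbb : 1 ⊗ₜ b = b') :
    Function.Injective (wordHom a b ha hb) ↔ Function.Injective (wordHom a' b' ha' hb') := by
  let f : R →+* ℂ ⊗[ℤ] R := (Algebra.TensorProduct.includeRight : R →ₐ[ℤ] ℂ ⊗[ℤ] R)
  refine ⟨fun h => ?_, injective_wordHom_of_map f ha hb ha' hb' haa hbb⟩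
  rw [injective_iff_map_eq_one]
  intro w hw
  have h0 : f (wordHom a b ha hb w - 1) = 0 := by
    rw [map_sub, map_wordHom f ha hb ha' hb' haa hbb, hw]
    simp
  obtain ⟨n, hn, hnw⟩ := exists_zsmul_eq_zero_of_one_tmul_eq_zero h0
  exact eq_one_of_zsmul_eq_zero ha hb h hn hnw

end FreePair

open FreePair in
theorem mainTheorem1 {R : Type*} [Ring R] [CharZero R] (a b : R) (ha : a ^ 2 = 0) (hb : b ^ 2 = 0) :
    -- eigenvalues taken in the canonical complex algebra attached to `R`
    (IsFreePair (1 + a) (1 + b) ↔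
      Transcendental ℚ ((1 : ℂ) ⊗ₜ[ℤ] (a * b)) ∨
        (IsAlgebraic ℚ ((1 : ℂ) ⊗ₜ[ℤ] (a * b)) ∧
          ∃ z : ℂ, IsEigenvalueOf ((1 : ℂ) ⊗ₜ[ℤ] (a * b)) z ∧ IsFreePoint z)) ∧
    -- eigenvalues taken in any complex algebra that contains `R`
    (∀ (A : Type*) [Ring A] [Algebra ℚ A] [Algebra ℂ A] (φ : R →+* A), Function.Injective φ →
      (IsFreePair (1 + a) (1 + b) ↔
        Transcendental ℚ (φ (a * b)) ∨
          (IsAlgebraic ℚ (φ (a * b)) ∧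
            ∃ z : ℂ, IsEigenvalueOf (φ (a * b)) z ∧ IsFreePoint z))) := by
  rw [isFreePair_iff ha hb]
  constructor
  · have hsq (x : R) (hx : x ^ 2 = 0) : ((1 : ℂ) ⊗ₜ[ℤ] x) ^ 2 = 0 := by
      rw [Algebra.TensorProduct.tmul_pow, hx, TensorProduct.tmul_zero]
    rw [wordHom_injective_iff_tensor ha hb (hsq a ha) (hsq b hb) rfl rfl,
      isFreePair_iff_of_complexAlgebra, Algebra.TensorProduct.tmul_mul_tmul, mul_one]
  · intro A _ _ _ φ hφ
    rw [wordHom_injective_iff_of_injective φ hφ ha hb (sq_map_eq_zero φ ha) (sq_map_eq_zero φ hb)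
      rfl rfl, isFreePair_iff_of_complexAlgebra, map_mul]
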